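/- Let $\mathbf{p} = 012102101021012101021012\cdots$ be the infinite word over $\{0,1,2\}$ that starts with $0$ and is the fixed point of the morphism $0 \mapsto 01$, $1 \mapsto 21$, $2 \mapsto 0$. A factor $w$ of $\mathbf{p}$ is called bispecial if there are letters $a \neq b$ such that $wa$ and $wb$ are both factors of $\mathbf{p}$, and letters $c \neq d$ such that $cw$ and $dw$ are both factors of $\mathbf{p}$. Let $X_1 = 1$, $X_2 = 2$, $X_3 = 4$, $X_4 = 7$, and $X_n = X_{n-1} + X_{n-2} + X_{n-4}$ for $n \geq 5$. Every integer $n \geq 1$ can be written uniquely as $n = \sum_{1 \leq i \leq t} e_i X_i$ with $e_i \in \{0,1\}$, $e_t = 1$, such that the binary word $e_t e_{t-1} \cdots e_1$ contains neither $111$ nor $1101$ as a factor; this word is the $P4$ representation $(n)_P$ of $n$. Theorem. For every integer $n \geq 1$, the word $\mathbf{p}$ has a bispecial factor of length $n$ if and only if $$(n)_P \in \{1, 11, 110\} \cup (10)^+\{\epsilon, 0\} \cup (1000)^+\{0, 01, 011, 0110\},$$ where $\epsilon$ is the empty word and $u^+ = \{u^k : k \geq 1\}$. -/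

import Mathlib

namespace PisotWord

/-! Factors and special factors of an infinite word. -/

/-- The finite word `w` is a factor of the infinite word `x`. -/
def IsFactor {α : Type*} (x : ℕ → α) (w : List α) : Prop :=
  ∃ i : ℕ, ∀ (j : ℕ) (hj : j < w.length), w[j] = x (i + j)

/-- `w` is a right-special factor of `x`. -/
def IsRightSpecial {α : Type*} (x : ℕ → α) (w : List α) : Prop :=
  IsFactor x w ∧ ∃ a b : α, a ≠ b ∧ IsFactor x (w ++ [a]) ∧ IsFactor x (w ++ [b])

/-- `w` is a left-special factor of `x`. -/
def IsLeftSpecial {α : Type*} (x : ℕ → α) (w : List α) : Prop :=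
  IsFactor x w ∧ ∃ a b : α, a ≠ b ∧ IsFactor x (a :: w) ∧ IsFactor x (b :: w)

/-- `w` is a bispecial factor of `x`. -/
def IsBispecial {α : Type*} (x : ℕ → α) (w : List α) : Prop :=
  IsRightSpecial x w ∧ IsLeftSpecial x w

/-! The infinite word `p`. -/

/-- The morphism `0 → 01`, `1 → 21`, `2 → 0` on letters. -/
def hLetter : Fin 3 → List (Fin 3)
  | 0 => [0, 1]
  | 1 => [2, 1]
  | 2 => [0]

/-- The morphism `0 → 01`, `1 → 21`, `2 → 0` on finite words. -/
def hMap (w : List (Fin 3)) : List (Fin 3) := w.flatMap hLetter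

theorem h_append (u v : List (Fin 3)) : hMap (u ++ v) = hMap u ++ hMap v := by
  simp [hMap]

theorem h_prefix {u v : List (Fin 3)} (huv : u <+: v) : hMap u <+: hMap v := by
  obtain ⟨t, rfl⟩ := huv
  exact ⟨hMap t, (h_append u t).symm⟩

theorem length_le_length_h (w : List (Fin 3)) : w.length ≤ (hMap w).length := by
  induction w with
  | nil => simp
  | cons a w ih =>
    have h1 : hMap (a :: w) = hLetter a ++ hMap w := by simp [hMap]
    have h2 : 1 ≤ (hLetter a).length := by fin_cases a <;> simp [hLetter]
    rw [h1, List.length_append, List.length_cons]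
    omega

/-- The word `h ^ n (0)`. -/
def hIter (n : ℕ) : List (Fin 3) := hMap^[n] [0]

theorem hIter_succ (n : ℕ) : hIter (n + 1) = hMap (hIter n) :=
  Function.iterate_succ_apply' hMap n [0]

theorem hIter_prefix_succ (n : ℕ) : hIter n <+: hIter (n + 1) := by
  induction n with
  | zero => exact ⟨[1], rfl⟩
  | succ n ih => rw [hIter_succ n, hIter_succ (n + 1)]; exact h_prefix ih

theorem lt_length_hIter (n : ℕ) : n < (hIter n).length := by
  have key : ∀ n : ℕ, ∃ t, hIter n = 0 :: t ∧ n ≤ t.length := by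
    intro n
    induction n with
    | zero => exact ⟨[], rfl, le_rfl⟩
    | succ n ih =>
      obtain ⟨t, ht, hn⟩ := ih
      refine ⟨1 :: hMap t, ?_, ?_⟩
      · rw [hIter_succ, ht]; simp [hMap, hLetter]
      · have := length_le_length_h t
        rw [List.length_cons]
        omega
  obtain ⟨t, ht, hn⟩ := key n
  rw [ht, List.length_cons]
  omega

/-- The infinite word `p = 012102101021...`, the limit of the words `h ^ n (0)`, each of which is
a prefix of the next; indexed from `0`. -/
def p (n : ℕ) : Fin 3 := (hIter n)[n]'(lt_length_hIter n)

theorem hIter_prefix {m n : ℕ} (hmn : m ≤ n) : hIter m <+: hIter n := by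
  induction n, hmn using Nat.le_induction with
  | base => exact List.prefix_rfl
  | succ n _ ih => exact ih.trans (hIter_prefix_succ n)

/-- Every `h ^ n (0)` is a prefix of `p`. -/
theorem hIter_getElem (n j : ℕ) (hj : j < (hIter n).length) : (hIter n)[j] = p j := by
  unfold p
  rcases le_total n j with hnj | hnj
  · exact (hIter_prefix hnj).getElem hj
  · exact ((hIter_prefix hnj).getElem (lt_length_hIter j)).symm

/-- `p` is fixed by `h`: the image of every finite prefix of `p` is a prefix of `p`. -/
theorem p_fixed (n : ℕ) (j : ℕ) (hj : j < (hMap ((List.range n).map p)).length) :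
    (hMap ((List.range n).map p))[j] = p j := by
  have hpre : (List.range n).map p <+: hIter n := by
    rw [List.prefix_iff_eq_take]
    apply List.ext_getElem
    · have := lt_length_hIter n
      simp
      omega
    · intro i h1 h2
      simp [hIter_getElem]
  have h2 := h_prefix hpre
  rw [← hIter_succ] at h2
  rw [h2.getElem hj, hIter_getElem]

/-! The numeration system `P4`. -/

/-- The weights `1, 2, 4, 7, 12, 21, ...`; the index starts at `0`, so `weight i = X_{i+1}`. -/
def weight : ℕ → ℕ
  | 0 => 1
  | 1 => 2
  | 2 => 4
  | 3 => 7
  | n + 4 => weight (n + 3) + weight (n + 2) + weight n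

/-- The value `∑ e_i X_i` of a binary word `e_t ... e_2 e_1`, most significant digit first. -/
def value : List (Fin 2) → ℕ
  | [] => 0
  | d :: w => (d : ℕ) * weight w.length + value w

/-- The word contains neither `111` nor `1101`. -/
def Admissible (w : List (Fin 2)) : Prop :=
  ¬ [1, 1, 1] <:+: w ∧ ¬ [1, 1, 0, 1] <:+: w

/-- `w` is a valid representation of `n`: no leading zero, neither `111` nor `1101` as a factor,
and value `n`. (The number `0` is represented by the empty word.) -/
def IsRep (n : ℕ) (w : List (Fin 2)) : Prop :=
  w.head? ≠ some 0 ∧ Admissible w ∧ value w = n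

theorem weight_add_le (n : ℕ) : weight (n + 1) + weight n ≤ weight (n + 2) := by
  match n with
  | 0 => simp [weight]
  | 1 => simp [weight]
  | n + 2 => rw [weight.eq_5]; simp only [Nat.add_assoc, Nat.reduceAdd] at *; omega

theorem weight_pos (n : ℕ) : 0 < weight n := by
  induction n with
  | zero => simp [weight]
  | succ n ih =>
    cases n with
    | zero => simp [weight]
    | succ n => have := weight_add_le n; simp only [Nat.add_assoc, Nat.reduceAdd] at *; omega

theorem weight_lt_succ (n : ℕ) : weight n < weight (n + 1) := by
  cases n with
  | zero => simp [weight]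
  | succ n =>
    have := weight_add_le n
    have := weight_pos n
    simp only [Nat.add_assoc, Nat.reduceAdd] at *; omega

theorem weight_mono : Monotone weight :=
  monotone_nat_of_le_succ fun n => (weight_lt_succ n).le

theorem weight_le_add (n : ℕ) : weight (n + 3) ≤ weight (n + 2) + weight (n + 1) + weight n := by
  match n with
  | 0 => simp [weight]
  | n + 1 =>
    have := weight_lt_succ n
    rw [weight.eq_5]; simp only [Nat.add_assoc, Nat.reduceAdd] at *; omega

theorem Admissible.of_cons {d : Fin 2} {w : List (Fin 2)} (hw : Admissible (d :: w)) :
    Admissible w :=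
  ⟨fun hi => hw.1 (hi.trans (List.suffix_cons d w).isInfix),
    fun hi => hw.2 (hi.trans (List.suffix_cons d w).isInfix)⟩

theorem value_lt (w : List (Fin 2)) (hw : Admissible w) : value w < weight w.length := by
  match w with
  | [] => simp [value, weight]
  | 0 :: w =>
    have := value_lt w hw.of_cons
    have := weight_lt_succ w.length
    simp [value]; omega
  | [1] => simp [value, weight]
  | 1 :: 0 :: w =>
    have := value_lt w hw.of_cons.of_cons
    have := weight_add_le w.length
    simp [value]; simp only [Nat.add_assoc, Nat.reduceAdd] at *; omega
  | [1, 1] => simp [value, weight]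
  | 1 :: 1 :: 1 :: w => exact absurd ⟨[], w, rfl⟩ hw.1
  | [1, 1, 0] => simp [value, weight]
  | 1 :: 1 :: 0 :: 1 :: w => exact absurd ⟨[], w, rfl⟩ hw.2
  | 1 :: 1 :: 0 :: 0 :: w =>
    have := value_lt w hw.of_cons.of_cons.of_cons.of_cons
    simp [value, weight]; simp only [Nat.add_assoc, Nat.reduceAdd] at *; omega

theorem eq_of_value_eq (u v : List (Fin 2)) (hu : Admissible u) (hv : Admissible v)
    (hl : u.length = v.length) (he : value u = value v) : u = v := by
  induction u generalizing v with
  | nil => exact (List.length_eq_zero_iff.mp hl.symm).symm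
  | cons a u ih =>
    cases v with
    | nil => simp at hl
    | cons b v =>
      have hl' : u.length = v.length := by simpa using hl
      have h1 := value_lt u hu.of_cons
      have h2 := value_lt v hv.of_cons
      simp only [value] at he
      rw [hl'] at he h1
      have hab : a = b := by
        fin_cases a <;> fin_cases b <;> simp at he ⊢ <;> omega
      subst hab
      rw [ih v hu.of_cons hv.of_cons hl' (by omega)]

theorem length_eq_of_isRep {n : ℕ} {u v : List (Fin 2)} (hu : IsRep n u) (hv : IsRep n v) :
    u.length ≤ v.length := by
  obtain ⟨hu0, -, hun⟩ := hu
  obtain ⟨-, hva, hvn⟩ := hv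
  cases u with
  | nil => simp
  | cons a u =>
    have ha : a = 1 := by
      fin_cases a
      · simp at hu0
      · rfl
    subst ha
    by_contra! hlt
    have h1 := value_lt v hva
    have h2 : weight v.length ≤ weight u.length := by
      apply weight_mono
      simp at hlt
      omega
    simp [value] at hun
    omega

theorem exists_admissible (k n : ℕ) (hn : n < weight k) :
    ∃ w : List (Fin 2), w.length = k ∧ Admissible w ∧ value w = n := by
  induction k generalizing n with
  | zero =>
    refine ⟨[], rfl, ⟨by simp, by simp⟩, ?_⟩
    simp [weight] at hn
    simp [value, hn]
  | succ k ih =>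
    by_cases hk : n < weight k
    · obtain ⟨w, hl, ha, hv⟩ := ih n hk
      refine ⟨0 :: w, by simp [hl], ⟨?_, ?_⟩, by simp [value, hv]⟩
      · rw [List.infix_cons_iff]
        rintro (hp | hp)
        · simp at hp
        · exact ha.1 hp
      · rw [List.infix_cons_iff]
        rintro (hp | hp)
        · simp at hp
        · exact ha.2 hp
    · have hlt : n - weight k < weight k := by
        match k with
        | 0 => simp [weight] at *; omega
        | 1 => simp [weight] at *; omega
        | 2 => simp [weight] at *; omega
        | k + 3 =>
          have h1 := weight_add_le (k + 1)
          have h2 := weight_lt_succ k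
          rw [weight.eq_5] at hn
          simp only [Nat.add_assoc, Nat.reduceAdd] at *
          omega
      obtain ⟨w, hl, ha, hv⟩ := ih _ hlt
      refine ⟨1 :: w, by simp [hl], ⟨?_, ?_⟩, by simp [value, hv, hl]; omega⟩
      · rw [List.infix_cons_iff]
        rintro (hp | hp)
        · obtain ⟨t, rfl⟩ := (List.cons_prefix_cons.mp hp).2
          simp at hl
          subst hl
          have := weight_le_add t.length
          simp [value] at hv
          simp only [Nat.add_assoc, Nat.reduceAdd] at *
          omega
        · exact ha.1 hp
      · rw [List.infix_cons_iff]
        rintro (hp | hp)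
        · obtain ⟨t, rfl⟩ := (List.cons_prefix_cons.mp hp).2
          simp at hl
          subst hl
          simp [value] at hv
          rw [weight.eq_5] at hn
          simp only [Nat.add_assoc, Nat.reduceAdd] at *
          omega
        · exact ha.2 hp

theorem exists_strip (w : List (Fin 2)) (hw : Admissible w) : ∃ u, IsRep (value w) u := by
  induction w with
  | nil => exact ⟨[], by simp, hw, rfl⟩
  | cons a w ih =>
    by_cases ha : a = 0
    · subst ha
      obtain ⟨u, hu⟩ := ih hw.of_cons
      exact ⟨u, by simpa [value] using hu⟩
    · exact ⟨a :: w, by simpa using ha, hw, rfl⟩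

theorem existsUnique_isRep (n : ℕ) : ∃! w : List (Fin 2), IsRep n w := by
  have hlt : n < weight n := by
    induction n with
    | zero => simp [weight]
    | succ n ih => have := weight_lt_succ n; omega
  obtain ⟨w, -, ha, hv⟩ := exists_admissible n n hlt
  obtain ⟨u, hu⟩ := exists_strip w ha
  rw [hv] at hu
  refine ⟨u, hu, fun v hv => ?_⟩
  exact eq_of_value_eq v u hv.2.1 hu.2.1
    (le_antisymm (length_eq_of_isRep hv hu) (length_eq_of_isRep hu hv)) (hv.2.2.trans hu.2.2.symm)

/-- The `P4` representation `(n)_P`: the unique valid representation of `n`. -/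
noncomputable def rep (n : ℕ) : List (Fin 2) := (existsUnique_isRep n).choose

theorem rep_eq_iff (n : ℕ) (w : List (Fin 2)) : rep n = w ↔ IsRep n w := by
  have hs := (existsUnique_isRep n).choose_spec
  exact ⟨fun hw => hw ▸ hs.1, fun hw => (hs.2 w hw).symm⟩

/-- The language `u⁺` of all powers `u ^ k` with `k ≥ 1`. -/
def plus (u : List (Fin 2)) : Language (Fin 2) :=
  {w | ∃ k : ℕ, 1 ≤ k ∧ w = (List.replicate k u).flatten}

/-- The language `{1, 11, 110} ∪ (10)⁺{ε, 0} ∪ (1000)⁺{0, 01, 011, 0110}`;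
`+` is union and `*` is concatenation of languages. -/
def bispecialLengths : Language (Fin 2) :=
  ({[1], [1, 1], [1, 1, 0]} : Language (Fin 2))
    + plus [1, 0] * ({[], [0]} : Language (Fin 2))
    + plus [1, 0, 0, 0] * ({[0], [0, 1], [0, 1, 1], [0, 1, 1, 0]} : Language (Fin 2))

end PisotWord

namespace PisotWord

/-! Factors of infinite words. -/

/-! In `p` every letter other than 1 opens a block h(a), and 1 never does, so factors can be pulled
back through h. The images of 0 and 1 both end in 1, and those of 0 and of 2 (which is always
followed by 1) both begin with 0. So when v is extended on the left by 0 and 1, a common 1 joins its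
image; when extended on the right by 0 and 2, a common 0 does. Every nonempty bispecial factor is
therefore `step l r v`, with v empty or a shorter bispecial factor whose extensions dictate the
flags. The empty v gives the seeds 1 and 10. From each seed the exact sets of extension pairs recur
with period 4 (`isFactor_chain_iff`) and leave only one choice of flags, so the bispecial factors
form two chains (`isBispecial_chain`, `IsBispecial.exists_eq_chain`).

For the lengths, the incidence matrix of h has characteristic polynomial x^3 - 2x^2 + x - 1, a
divisor of x^4 - x^3 - x^2 - 1, which governs the weights. The flags have period 2, so the letters
added by `step` cancel in the difference of Parikh vectors of two chain words at even distance, and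
the matrix merely shifts that difference along the weights. Four steps in the chain of 1, or two in
the chain of 10, thus add a single weight, which amounts to prepending 1000 or 10 to the
representation. Uniqueness of representations concludes. -/

theorem IsFactor.of_infix {α : Type*} {x : ℕ → α} {u v : List α} (hv : IsFactor x v)
    (huv : u <:+: v) : IsFactor x u := by
  obtain ⟨s, t, rfl⟩ := huv
  obtain ⟨i, hi⟩ := hv
  refine ⟨i + s.length, fun j hj => ?_⟩
  have := hi (s.length + j) (by simp; omega)
  rw [Nat.add_assoc, ← this]
  simp [hj]

theorem IsFactor.exists_append {α : Type*} {x : ℕ → α} {w : List α} (hw : IsFactor x w) :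
    ∃ a, IsFactor x (w ++ [a]) := by
  obtain ⟨i, hi⟩ := hw
  refine ⟨x (i + w.length), i, fun j hj => ?_⟩
  rcases Nat.lt_or_ge j w.length with h | h
  · rw [List.getElem_append_left h, hi j h]
  · obtain rfl : j = w.length := by simp at hj; omega
    simp

theorem isFactor_p_iff {w : List (Fin 3)} : IsFactor p w ↔ ∃ n, w <:+: hIter n := by
  constructor
  · rintro ⟨i, hi⟩
    refine ⟨i + w.length, ?_⟩
    have hlen := lt_length_hIter (i + w.length)
    have hw : w = ((hIter (i + w.length)).drop i).take w.length := by
      apply List.ext_getElem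
      · simp; omega
      · intro j h1 h2
        simp [hi j h1, hIter_getElem]
    rw [hw]
    exact (List.take_prefix _ _).isInfix.trans (by
      rw [← hw]
      exact (List.drop_suffix _ _).isInfix)
  · rintro ⟨n, s, t, h⟩
    refine ⟨s.length, fun j hj => ?_⟩
    have hlt : s.length + j < (hIter n).length := by rw [← h]; simp; omega
    rw [← hIter_getElem n _ hlt]
    simp [← h, hj]

theorem IsFactor.exists_hMap {w : List (Fin 3)} (hw : IsFactor p w) :
    ∃ n s t, hMap (hIter n) = s ++ (w ++ t) := by
  obtain ⟨n, hn⟩ := isFactor_p_iff.mp hw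
  obtain ⟨s, t, h⟩ := hn.trans (hIter_prefix_succ n).isInfix
  exact ⟨n, s, t, by rw [← hIter_succ, ← h]; simp⟩

theorem IsFactor.of_hIter {w : List (Fin 3)} (n : ℕ) (h : w <:+: hIter n) : IsFactor p w :=
  isFactor_p_iff.mpr ⟨n, h⟩

theorem hMap_cons (a : Fin 3) (w : List (Fin 3)) : hMap (a :: w) = hLetter a ++ hMap w := by
  simp [hMap]

@[simp] theorem hMap_nil : hMap [] = [] := rfl

@[simp] theorem hMap_zero_cons (w : List (Fin 3)) : hMap (0 :: w) = 0 :: 1 :: hMap w :=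
  hMap_cons 0 w

@[simp] theorem hMap_one_cons (w : List (Fin 3)) : hMap (1 :: w) = 2 :: 1 :: hMap w :=
  hMap_cons 1 w

@[simp] theorem hMap_two_cons (w : List (Fin 3)) : hMap (2 :: w) = 0 :: hMap w :=
  hMap_cons 2 w

theorem letter_cases (a : Fin 3) : a = 0 ∨ a = 1 ∨ a = 2 := by
  revert a; decide

theorem IsFactor.map {w : List (Fin 3)} (hw : IsFactor p w) : IsFactor p (hMap w) := by
  obtain ⟨n, s, t, h⟩ := isFactor_p_iff.mp hw
  refine IsFactor.of_hIter (n + 1) ⟨hMap s, hMap t, ?_⟩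
  rw [hIter_succ, ← h, h_append, h_append]

/-! Desubstitution. -/

theorem head?_hMap_ne (w : List (Fin 3)) : (hMap w).head? ≠ some 1 := by
  cases w with
  | nil => simp
  | cons a w => rcases letter_cases a with rfl | rfl | rfl <;> simp

/-- The second letter of a two-letter block is always 1, so a cut not followed by 1 falls between
blocks. -/
theorem exists_of_hMap_eq_append {x s t : List (Fin 3)} (h : hMap x = s ++ t)
    (ht : t.head? ≠ some 1) : ∃ y z, hMap y = s ∧ hMap z = t := by
  induction x generalizing s with
  | nil => exact ⟨[], [], by simp_all⟩
  | cons a x ih =>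
    cases s with
    | nil => exact ⟨[], a :: x, by simpa using h⟩
    | cons b s =>
      rcases letter_cases a with rfl | rfl | rfl
      · cases s with
        | nil =>
          simp only [hMap_zero_cons, List.cons_append, List.cons.injEq, List.nil_append] at h
          rw [← h.2] at ht
          simp at ht
        | cons c s =>
          simp only [hMap_zero_cons, List.cons_append, List.cons.injEq] at h
          obtain ⟨y, z, hy, hz⟩ := ih h.2.2
          exact ⟨0 :: y, z, by simp [hy, ← h.1, ← h.2.1], hz⟩
      · cases s with
        | nil =>
          simp only [hMap_one_cons, List.cons_append, List.cons.injEq, List.nil_append] at h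
          rw [← h.2] at ht
          simp at ht
        | cons c s =>
          simp only [hMap_one_cons, List.cons_append, List.cons.injEq] at h
          obtain ⟨y, z, hy, hz⟩ := ih h.2.2
          exact ⟨1 :: y, z, by simp [hy, ← h.1, ← h.2.1], hz⟩
      · simp only [hMap_two_cons, List.cons_append, List.cons.injEq] at h
        obtain ⟨y, z, hy, hz⟩ := ih h.2
        exact ⟨2 :: y, z, by simp [hy, ← h.1], hz⟩

theorem hMap_injective : Function.Injective hMap := by
  intro u
  induction u with
  | nil =>
    intro v h
    cases v with
    | nil => rfl
    | cons b v => rcases letter_cases b with rfl | rfl | rfl <;> simp at h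
  | cons a u ih =>
    intro v h
    cases v with
    | nil => rcases letter_cases a with rfl | rfl | rfl <;> simp at h
    | cons b v =>
      have hu := head?_hMap_ne u
      have hv := head?_hMap_ne v
      rcases letter_cases a with rfl | rfl | rfl <;> rcases letter_cases b with rfl | rfl | rfl <;>
        simp at h
      · rw [ih h]
      · rw [← h] at hv
        simp at hv
      · rw [ih h]
      · rw [h] at hu
        simp at hu
      · rw [ih h]


/-- Since d opens a block, `hMap u` is a union of whole blocks there, and injectivity identifies its
preimage as u. For d = 0 the letter e may still be 0 or 2. -/
theorem IsFactor.desubstitute {u : List (Fin 3)} {d : Fin 3} (h : IsFactor p (hMap u ++ [d]))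
    (hd : d ≠ 1) : ∃ e, IsFactor p (u ++ [e]) ∧ (hLetter e).head? = some d := by
  obtain ⟨n, s, t, hx⟩ := h.exists_hMap
  have hut : (hMap u ++ [d] ++ t).head? ≠ some 1 := by
    have := head?_hMap_ne u
    cases h' : hMap u with
    | nil => simpa using hd
    | cons b l => simpa [h'] using this
  obtain ⟨y, z, hy, hz⟩ := exists_of_hMap_eq_append hx hut
  rw [List.append_assoc] at hz
  obtain ⟨y', z', hy', hz'⟩ := exists_of_hMap_eq_append hz (by simpa using hd)
  obtain rfl := hMap_injective hy'
  have hxe : hIter n = y ++ (y' ++ z') := hMap_injective (by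
    rw [h_append, h_append, hy, hz', hx, hy', List.append_assoc])
  cases z' with
  | nil => simp at hz'
  | cons e z' =>
    refine ⟨e, IsFactor.of_hIter n ⟨y, z', by simp [hxe]⟩, ?_⟩
    rcases letter_cases e with rfl | rfl | rfl <;> simp at hz' <;> simp [hLetter, hz'.1]

theorem IsFactor.exists_hMap_eq {u : List (Fin 3)} {d : Fin 3} (h : IsFactor p (u ++ [d]))
    (hd : d ≠ 1) (hu : u.head? ≠ some 1) : ∃ v, hMap v = u := by
  obtain ⟨n, s, t, hx⟩ := h.exists_hMap
  have hut : (u ++ [d] ++ t).head? ≠ some 1 := by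
    cases u with
    | nil => simpa using hd
    | cons b l => simpa using hu
  obtain ⟨y, z, hy, hz⟩ := exists_of_hMap_eq_append hx hut
  rw [List.append_assoc] at hz
  obtain ⟨y', z', hy', hz'⟩ := exists_of_hMap_eq_append hz (by simpa using hd)
  exact ⟨y', hy'⟩

theorem exists_of_hMap_eq_append_one {x s t : List (Fin 3)} (h : hMap x = s ++ 1 :: t) :
    ∃ s' a, s = s' ++ [a] ∧ a ≠ 1 := by
  induction x generalizing s with
  | nil => simp at h
  | cons a x ih =>
    cases s with
    | nil =>
      have := head?_hMap_ne (a :: x)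
      simp [h] at this
    | cons b s =>
      cases s with
      | nil =>
        refine ⟨[], b, rfl, ?_⟩
        rintro rfl
        have := head?_hMap_ne (a :: x)
        simp [h] at this
      | cons c s =>
        have key : ∀ q r, hMap x = r ++ 1 :: t → b :: c :: s = q ++ r →
            ∃ s' a, b :: c :: s = s' ++ [a] ∧ a ≠ 1 := by
          intro q r hr hs
          obtain ⟨s', a, rfl, ha⟩ := ih hr
          exact ⟨_, a, hs.trans (List.append_assoc _ _ _).symm, ha⟩
        rcases letter_cases a with rfl | rfl | rfl <;> simp at h
        · exact key [b, c] s h.2.2 rfl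
        · exact key [b, c] s h.2.2 rfl
        · exact key [b] (c :: s) h.2 rfl

theorem IsFactor.exists_cons_one {u : List (Fin 3)} (h : IsFactor p (1 :: u)) :
    ∃ a, a ≠ 1 ∧ IsFactor p (a :: 1 :: u) := by
  obtain ⟨n, s, t, hx⟩ := h.exists_hMap
  obtain ⟨s', a, rfl, ha⟩ := exists_of_hMap_eq_append_one (by simpa using hx)
  refine ⟨a, ha, IsFactor.of_hIter (n + 1) ⟨s', t, ?_⟩⟩
  rw [hIter_succ, hx]
  simp

/-! ### Factors of length two. -/

theorem not_isFactor_one_one : ¬ IsFactor p [1, 1] := by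
  intro h
  obtain ⟨n, s, t, hx⟩ := h.exists_hMap
  obtain ⟨s', a, hs, ha⟩ := exists_of_hMap_eq_append_one (s := s ++ [1]) (t := t) (by simpa using hx)
  exact ha (by simpa using (List.append_inj' hs rfl).2.symm)

theorem eq_one_of_isFactor_two {b : Fin 3} (h : IsFactor p [2, b]) : b = 1 := by
  obtain ⟨n, s, t, hx⟩ := h.exists_hMap
  obtain ⟨y, z, hy, hz⟩ := exists_of_hMap_eq_append hx (by simp)
  cases z with
  | nil => simp at hz
  | cons e z => rcases letter_cases e with rfl | rfl | rfl <;> simp at hz; exact hz.1.symm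

theorem isFactor_pair_iff {a b : Fin 3} :
    IsFactor p [a, b] ↔ (a, b) ∈ ({(0, 1), (0, 2), (1, 0), (1, 2), (2, 1)} : Finset _) := by
  constructor
  · intro h
    have h00 : ¬ (a = 0 ∧ b = 0) := by
      rintro ⟨rfl, rfl⟩
      -- The word 00 would be h(2) followed by 0, so would come from 2e; but e = 1 is forced, and
      -- h(1) begins with 2.
      obtain ⟨e, he, hd⟩ := IsFactor.desubstitute (u := [2]) (d := 0) (by simpa using h) (by decide)
      obtain rfl := eq_one_of_isFactor_two (by simpa using he)
      simp [hLetter] at hd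
    have h11 : ¬ (a = 1 ∧ b = 1) := by
      rintro ⟨rfl, rfl⟩
      exact not_isFactor_one_one h
    have h2 : a = 2 → b = 1 := by
      rintro rfl
      exact eq_one_of_isFactor_two h
    clear h
    revert a b
    decide
  · intro h
    refine IsFactor.of_hIter 6 ?_
    revert a b
    decide

theorem IsFactor.left {u v : List (Fin 3)} (h : IsFactor p (u ++ v)) : IsFactor p u :=
  h.of_infix (List.prefix_append u v).isInfix

theorem IsFactor.right {u v : List (Fin 3)} (h : IsFactor p (u ++ v)) : IsFactor p v :=
  h.of_infix (List.suffix_append u v).isInfix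

theorem IsFactor.pair {u v : List (Fin 3)} {a b : Fin 3} (h : IsFactor p (u ++ a :: b :: v)) :
    (a, b) ∈ ({(0, 1), (0, 2), (1, 0), (1, 2), (2, 1)} : Finset _) :=
  isFactor_pair_iff.mp (h.of_infix ⟨u, v, by simp⟩)

/-! The step from one bispecial factor to the next. -/

/-- The word `h(v)`, preceded by `1` if `l` holds and followed by `0` if `r` holds. -/
def step (l r : Bool) (v : List (Fin 3)) : List (Fin 3) :=
  (if l then [1] else []) ++ hMap v ++ (if r then [0] else [])

/-- The letter preceding `step l r v` in the image of an occurrence of `v` preceded by `a`. -/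
def leftImage : Bool → Fin 3 → Fin 3
  | false, a => ![1, 1, 0] a
  | true, a => ![0, 2, 2] a

/-- The letter following `step l r v` in the image of an occurrence of `v` followed by `a`. -/
def rightImage : Bool → Fin 3 → Fin 3
  | false, a => ![0, 2, 0] a
  | true, a => ![1, 2, 2] a

/-- The condition on the last letter excludes d = 1 when r is false: a final 0 read as h(2) but
followed by 1 would really belong to the block 01. -/
theorem IsFactor.of_map_right {u : List (Fin 3)} {r : Bool} {d : Fin 3}
    (h : IsFactor p (hMap u ++ (if r then [0] else []) ++ [d]))
    (hu : (hMap u).getLast? = some 1) :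
    ∃ e, IsFactor p (u ++ [e]) ∧ (r = true → e ≠ 1) ∧ rightImage r e = d := by
  cases r with
  | false =>
    simp only [Bool.false_eq_true, if_false, List.append_nil] at h
    have hd : d ≠ 1 := by
      rintro rfl
      obtain ⟨s, hs⟩ := List.getLast?_eq_some_iff.mp hu
      rw [hs, List.append_assoc] at h
      have := h.pair
      revert this
      decide
    obtain ⟨e, he, hed⟩ := h.desubstitute hd
    refine ⟨e, he, by simp, ?_⟩
    clear h he
    revert e d
    decide
  | true =>
    simp only [if_true, List.append_assoc, List.cons_append, List.nil_append] at h
    have hd := h.pair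
    have hd' : d = 1 ∨ d = 2 := by
      clear h
      revert d
      decide
    rcases hd' with rfl | rfl
    -- One further letter f ≠ 1 shows where the block 01 = h(0) ends. In the other case the 2 itself
    -- shows that 0 is the block h(2).
    · obtain ⟨f, hf⟩ := h.exists_append
      have hf1 : f ≠ 1 := by
        rintro rfl
        have := IsFactor.pair (u := hMap u ++ [0]) (v := []) (a := 1) (b := 1) (by simpa using hf)
        revert this
        decide
      obtain ⟨e, he, -⟩ := IsFactor.desubstitute (u := u ++ [0]) (d := f)
        (by simpa [h_append] using hf) hf1
      exact ⟨0, he.left, by simp, rfl⟩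
    · obtain ⟨e, he, -⟩ := IsFactor.desubstitute (u := u ++ [2]) (d := 2)
        (by simpa [h_append] using h) (by decide)
      exact ⟨2, he.left, by simp, rfl⟩

theorem IsFactor.of_map_left {v z : List (Fin 3)} {l : Bool} {c : Fin 3}
    (h : IsFactor p (c :: ((if l then [1] else []) ++ (hMap v ++ z)))) (hv : v ≠ []) :
    ∃ a, IsFactor p (hMap (a :: v) ++ z) ∧ (l = true → a ≠ 2) ∧ leftImage l a = c := by
  cases l with
  | true =>
    simp only [if_true, List.cons_append, List.nil_append] at h
    have hc := IsFactor.pair (u := []) h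
    have hc' : c = 0 ∨ c = 2 := by
      clear h
      revert c
      decide
    rcases hc' with rfl | rfl
    · exact ⟨0, by simpa using h, by simp, rfl⟩
    · exact ⟨1, by simpa using h, by simp, rfl⟩
  | false =>
    simp only [Bool.false_eq_true, if_false, List.nil_append] at h
    rcases letter_cases c with rfl | rfl | rfl
    · exact ⟨2, by simpa using h, by simp, rfl⟩
    · obtain ⟨a, ha, h'⟩ := h.exists_cons_one
      rcases letter_cases a with rfl | rfl | rfl
      · exact ⟨0, by simpa using h', by simp, rfl⟩
      · exact absurd rfl ha
      · exact ⟨1, by simpa using h', by simp, rfl⟩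
    · exfalso
      have hh := head?_hMap_ne v
      cases hm : hMap v with
      | nil => exact hv (hMap_injective hm)
      | cons b w =>
        rw [hm] at h hh
        have := IsFactor.pair (u := []) (v := w ++ z) (a := 2) (b := b) (by simpa using h)
        simp only [List.head?_cons, ne_eq, Option.some.injEq] at hh
        clear h hm
        revert b
        decide

theorem getLast?_hMap_cons {a : Fin 3} {v : List (Fin 3)} (hv : (hMap v).getLast? = some 1) :
    (hMap (a :: v)).getLast? = some 1 := by
  obtain ⟨s, hs⟩ := List.getLast?_eq_some_iff.mp hv
  rw [hMap_cons, hs, ← List.append_assoc]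
  simp

/-- The exclusions a ≠ 2 and b ≠ 1 avoid the placeholder entries of `leftImage true` and `rightImage
true`: h(2) does not end in 1, and h(1) does not begin with 0. -/
theorem IsFactor.of_step {v : List (Fin 3)} {l r : Bool} {c d : Fin 3}
    (h : IsFactor p (c :: step l r v ++ [d])) (hv : (hMap v).getLast? = some 1) :
    ∃ a b, IsFactor p (a :: v ++ [b]) ∧ (l = true → a ≠ 2) ∧ (r = true → b ≠ 1) ∧
      leftImage l a = c ∧ rightImage r b = d := by
  obtain ⟨a, ha, hl, hc⟩ := IsFactor.of_map_left (v := v) (c := c) (l := l)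
    (z := (if r then [0] else []) ++ [d]) (by simpa [step] using h) (by rintro rfl; simp at hv)
  rw [← List.append_assoc] at ha
  obtain ⟨b, hb, hr, hd⟩ := ha.of_map_right (getLast?_hMap_cons hv)
  exact ⟨a, b, hb, hl, hr, hc, hd⟩

theorem IsFactor.map_step {v : List (Fin 3)} {l r : Bool} {a b : Fin 3}
    (h : IsFactor p (a :: v ++ [b])) (hl : l = true → a ≠ 2) (hr : r = true → b ≠ 1) :
    IsFactor p (leftImage l a :: step l r v ++ [rightImage r b]) := by
  -- When b = 2 and r holds, h(b) = 0 is used up by `step`, and the letter after it comes from the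
  -- next block h(e).
  obtain ⟨e, he⟩ := h.exists_append
  have hbe : (b, e) ∈ ({(0, 1), (0, 2), (1, 0), (1, 2), (2, 1)} : Finset _) :=
    IsFactor.pair (u := a :: v) (v := []) (by simpa using he)
  have hleft : ∃ s, hLetter a = s ++ leftImage l a :: (if l then [1] else []) := by
    cases l
    · rcases letter_cases a with rfl | rfl | rfl
      exacts [⟨[0], rfl⟩, ⟨[2], rfl⟩, ⟨[], rfl⟩]
    · rcases letter_cases a with rfl | rfl | rfl
      exacts [⟨[], rfl⟩, ⟨[], rfl⟩, absurd rfl (hl rfl)]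
  have hright : ∃ t, hLetter b ++ hLetter e = (if r then [0] else []) ++ rightImage r b :: t := by
    cases r
    · rcases letter_cases b with rfl | rfl | rfl
      exacts [⟨_, rfl⟩, ⟨_, rfl⟩, ⟨_, rfl⟩]
    · rcases letter_cases b with rfl | rfl | rfl
      · exact ⟨_, rfl⟩
      · exact absurd rfl (hr rfl)
      · obtain rfl : e = 1 := by
          clear he
          revert e
          decide
        exact ⟨_, rfl⟩
  obtain ⟨s, hs⟩ := hleft
  obtain ⟨t, ht⟩ := hright
  refine he.map.of_infix ⟨s, t, ?_⟩
  have : hMap (a :: v ++ [b] ++ [e]) = hLetter a ++ (hMap v ++ (hLetter b ++ hLetter e)) := by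
    rw [List.append_assoc, h_append, hMap_cons]
    simp [hMap]
  rw [this, hs, ht]
  simp [step]


/-! The two chains of bispecial factors. -/

/-- The two chains of bispecial factors, starting from `1` and from `10`. -/
def chain (s : Bool) : ℕ → List (Fin 3)
  | 0 => if s then [1] else [1, 0]
  | n + 1 => step (n % 2 == 1) ((n % 2 == 1) ^^ s) (chain s n)

/-- The pairs of letters that extend `chain s n` on both sides; they only depend on `n % 4`. -/
def extSet : Bool → ℕ → Finset (Fin 3 × Fin 3)
  | true, 0 => {(0, 0), (0, 2), (2, 0)}
  | true, 1 => {(0, 1), (1, 1), (1, 2)}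
  | true, 2 => {(0, 2), (2, 0), (2, 2)}
  | true, _ => {(0, 1), (0, 2), (1, 2)}
  | false, 0 => {(0, 2), (2, 1), (2, 2)}
  | false, 1 => {(0, 0), (0, 2), (1, 0)}
  | false, 2 => {(0, 1), (0, 2), (2, 1)}
  | false, _ => {(0, 2), (1, 0), (1, 2)}

theorem isFactor_around_one {c d : Fin 3} :
    IsFactor p (c :: [1] ++ [d]) ↔ (c, d) ∈ extSet true 0 := by
  constructor
  · intro h
    have h1 := IsFactor.pair (u := []) (a := c) (b := 1) (v := [d]) h
    have h2 := IsFactor.pair (u := [c]) (a := 1) (b := d) (v := []) h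
    have h3 : ¬ (c = 2 ∧ d = 2) := by
      rintro ⟨rfl, rfl⟩
      -- The word 212 could only come from 11.
      obtain ⟨e, he, hd⟩ := IsFactor.desubstitute (u := [1]) (d := 2) (by simpa using h) (by decide)
      have he' := IsFactor.pair (u := []) (v := []) he
      clear h h1 h2
      clear he
      revert e
      decide
    clear h
    revert c d
    decide
  · intro h
    refine IsFactor.of_hIter 6 ?_
    revert c d
    decide

theorem isFactor_around_one_zero {c d : Fin 3} :
    IsFactor p (c :: [1, 0] ++ [d]) ↔ (c, d) ∈ extSet false 0 := by
  constructor
  · intro h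
    have h1 := IsFactor.pair (u := []) (a := c) (b := 1) (v := [0, d]) h
    have h2 := IsFactor.pair (u := [c, 1]) (a := 0) (b := d) (v := []) h
    have h3 : ¬ (c = 0 ∧ d = 1) := by
      rintro ⟨rfl, rfl⟩
      obtain ⟨f, hf⟩ := h.exists_append
      have hf1 : f ≠ 1 := by
        rintro rfl
        exact not_isFactor_one_one (hf.of_infix ⟨[0, 1, 0], [], rfl⟩)
      obtain ⟨e, he, hd⟩ := IsFactor.desubstitute (u := [0, 0]) (d := f) (by simpa using hf) hf1
      have := IsFactor.pair (u := []) (v := [e]) (a := 0) (b := 0) he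
      revert this
      decide
    clear h
    revert c d
    decide
  · intro h
    refine IsFactor.of_hIter 6 ?_
    revert c d
    decide

/-- Pairs, rather than left and right letters separately, are transported, so that the induction
along a chain closes. The condition `hlr` ensures that no pair of E is lost. -/
theorem isFactor_step_iff {v : List (Fin 3)} {l r : Bool} {E : Finset (Fin 3 × Fin 3)}
    (hv : (hMap v).getLast? = some 1)
    (hE : ∀ a b, IsFactor p (a :: v ++ [b]) ↔ (a, b) ∈ E)
    (hlr : ∀ q ∈ E, (l = true → q.1 ≠ 2) ∧ (r = true → q.2 ≠ 1)) (c d : Fin 3) :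
    IsFactor p (c :: step l r v ++ [d]) ↔
      (c, d) ∈ E.image fun q => (leftImage l q.1, rightImage r q.2) := by
  rw [Finset.mem_image]
  constructor
  · intro h
    obtain ⟨a, b, hab, -, -, rfl, rfl⟩ := h.of_step hv
    exact ⟨(a, b), (hE a b).mp hab, rfl⟩
  · rintro ⟨⟨a, b⟩, hq, h⟩
    simp only [Prod.mk.injEq] at h
    obtain ⟨rfl, rfl⟩ := h
    exact ((hE a b).mpr hq).map_step (hlr _ hq).1 (hlr _ hq).2

theorem getLast?_hMap {v : List (Fin 3)} (hv : v ≠ []) (h2 : IsFactor p (v ++ [2])) :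
    (hMap v).getLast? = some 1 := by
  obtain ⟨w, a, rfl⟩ : ∃ w a, v = w ++ [a] := ⟨_, _, (List.dropLast_append_getLast hv).symm⟩
  have := IsFactor.pair (u := w) (v := []) (a := a) (b := 2) (by simpa using h2)
  rw [h_append]
  rcases letter_cases a with rfl | rfl | rfl
  · simp
  · simp
  · exact absurd this (by decide)

theorem chain_ne_nil (s : Bool) (n : ℕ) : chain s n ≠ [] := by
  induction n with
  | zero => cases s <;> simp [chain]
  | succ n ih =>
    intro h
    have : hMap (chain s n) = [] := by
      rw [chain, step] at h
      simp only [List.append_eq_nil_iff] at h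
      exact h.1.2
    exact ih (hMap_injective this)

theorem isFactor_chain_iff (s : Bool) (n : ℕ) (c d : Fin 3) :
    IsFactor p (c :: chain s n ++ [d]) ↔ (c, d) ∈ extSet s (n % 4) := by
  induction n generalizing c d with
  | zero => cases s <;> [exact isFactor_around_one_zero; exact isFactor_around_one]
  | succ n ih =>
    -- A chain word that can be followed by 2 ends in 0 or 1, so its image ends in 1, as the
    -- pull-back requires.
    have hq : ∃ a, (a, 2) ∈ extSet s (n % 4) := by
      clear ih
      have := Nat.mod_lt n (show 4 > 0 by decide)
      generalize n % 4 = m at this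
      revert s m
      decide
    obtain ⟨a, ha⟩ := hq
    have hv := getLast?_hMap (chain_ne_nil s n) (IsFactor.right (u := [a]) ((ih a 2).mpr ha))
    have hparity : n % 2 = n % 4 % 2 := by omega
    rw [chain, isFactor_step_iff hv ih, Nat.add_mod, hparity]
    · have := Nat.mod_lt n (show 4 > 0 by decide)
      clear ih ha hv hparity
      generalize n % 4 = m at this
      revert c d s m
      decide
    · have := Nat.mod_lt n (show 4 > 0 by decide)
      rw [hparity]
      clear ih ha hv hparity
      generalize n % 4 = m at this
      revert s m
      decide

/-- A prefix of `p` needs another occurrence with a letter before it. The factor 10 provides one for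
h^0(0), and applying h carries it to every h^n(0). -/
theorem IsFactor.exists_cons {w : List (Fin 3)} (hw : IsFactor p w) :
    ∃ a, IsFactor p (a :: w) := by
  have key : ∀ n, ∃ a, IsFactor p (a :: hIter n) := by
    intro n
    induction n with
    | zero => exact ⟨1, IsFactor.of_hIter 4 (by decide)⟩
    | succ n ih =>
      obtain ⟨a, ha⟩ := ih
      have h := ha.map
      rw [hMap_cons, ← hIter_succ] at h
      rcases letter_cases a with rfl | rfl | rfl
      exacts [⟨1, IsFactor.right (u := [0]) h⟩, ⟨1, IsFactor.right (u := [2]) h⟩, ⟨0, h⟩]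
  obtain ⟨n, s, t, hst⟩ := isFactor_p_iff.mp hw
  obtain ⟨a, ha⟩ := key n
  rw [← hst] at ha
  rcases List.eq_nil_or_concat' s with rfl | ⟨s', b, rfl⟩
  · exact ⟨a, ha.of_infix ⟨[], t, by simp⟩⟩
  · exact ⟨b, ha.of_infix ⟨a :: s', t, by simp⟩⟩

theorem eq_of_isFactor_cons_chain {s : Bool} {n : ℕ} {c : Fin 3} (h : IsFactor p (c :: chain s n)) :
    c = 0 ∨ c = bif n % 2 == 1 then 1 else 2 := by
  obtain ⟨d, hd⟩ := h.exists_append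
  have hcd := (isFactor_chain_iff s n c d).mp hd
  rw [show n % 2 = n % 4 % 2 by omega]
  have hn := Nat.mod_lt n (show 4 > 0 by decide)
  clear h hd
  generalize n % 4 = m at *
  clear n
  revert hcd
  revert m
  revert c d s
  decide

theorem eq_of_isFactor_chain_append {s : Bool} {n : ℕ} {d : Fin 3}
    (h : IsFactor p (chain s n ++ [d])) : d = 2 ∨ d = bif (n % 2 == 1) ^^ s then 0 else 1 := by
  obtain ⟨c, hc⟩ := h.exists_cons
  have hcd := (isFactor_chain_iff s n c d).mp hc
  rw [show n % 2 = n % 4 % 2 by omega]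
  have hn := Nat.mod_lt n (show 4 > 0 by decide)
  clear h hc
  generalize n % 4 = m at *
  clear n
  revert hcd
  revert m
  revert c d s
  decide

theorem isBispecial_chain (s : Bool) (n : ℕ) : IsBispecial p (chain s n) := by
  have h : ∃ a b c d e f, (a, b) ∈ extSet s (n % 4) ∧ (c, d) ∈ extSet s (n % 4) ∧
      (e, f) ∈ extSet s (n % 4) ∧ a ≠ c ∧ b ≠ f := by
    have := Nat.mod_lt n (show 4 > 0 by decide)
    generalize n % 4 = m at this
    cases s <;> interval_cases m
    exacts [⟨0, 2, 2, 1, 2, 1, by decide⟩, ⟨0, 2, 1, 0, 1, 0, by decide⟩,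
      ⟨0, 2, 2, 1, 2, 1, by decide⟩, ⟨0, 2, 1, 0, 1, 0, by decide⟩,
      ⟨0, 2, 2, 0, 2, 0, by decide⟩, ⟨0, 1, 1, 2, 1, 2, by decide⟩,
      ⟨0, 2, 2, 0, 2, 0, by decide⟩, ⟨0, 1, 1, 2, 1, 2, by decide⟩]
  obtain ⟨a, b, c, d, e, f, h1, h2, h3, hac, hbf⟩ := h
  simp only [← isFactor_chain_iff] at h1 h2 h3
  have hF : IsFactor p (chain s n) := IsFactor.right (u := [a]) h1.left
  exact ⟨⟨hF, b, f, hbf, IsFactor.right (u := [a]) h1, IsFactor.right (u := [e]) h3⟩,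
    hF, a, c, hac, h1.left, h2.left⟩


/-! Every nonempty bispecial factor is in one of the two chains. -/

theorem IsLeftSpecial.head?_ne_zero {w : List (Fin 3)} (h : IsLeftSpecial p w) :
    w.head? ≠ some 0 := by
  obtain ⟨-, a, b, hab, ha, hb⟩ := h
  cases w with
  | nil => simp
  | cons x w =>
    rintro h
    obtain rfl : x = 0 := by simpa using h
    replace ha := IsFactor.pair (u := []) ha
    replace hb := IsFactor.pair (u := []) hb
    clear h
    revert a b
    decide

theorem IsRightSpecial.getLast?_ne_two {w : List (Fin 3)} (h : IsRightSpecial p w) :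
    w.getLast? ≠ some 2 := by
  obtain ⟨-, a, b, hab, ha, hb⟩ := h
  intro h
  obtain ⟨s, rfl⟩ := List.getLast?_eq_some_iff.mp h
  replace ha := IsFactor.pair (u := s) (v := []) (a := 2) (b := a) (by simpa using ha)
  replace hb := IsFactor.pair (u := s) (v := []) (a := 2) (b := b) (by simpa using hb)
  clear h
  revert a b
  decide

/-- A bispecial word neither starts with 0 nor ends in 2. Once an initial 1 and a final 0 are
removed, both ends are block boundaries: the removed 0 opens a block, and without it
right-speciality supplies a following letter other than 1. -/
theorem IsBispecial.exists_eq_step {w : List (Fin 3)} (h : IsBispecial p w) :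
    ∃ l r v, w = step l r v ∧ (v ≠ [] → r = false → w.getLast? = some 1) := by
  have h0 := h.2.head?_ne_zero
  have h2 := h.1.getLast?_ne_two
  obtain ⟨l, m, hw, hm⟩ : ∃ (l : Bool) (m : List (Fin 3)),
      w = (if l then [1] else []) ++ m ∧ m.head? ≠ some 1 := by
    by_cases h1 : w.head? = some 1
    · obtain ⟨m, rfl⟩ : ∃ m, w = 1 :: m := by
        cases w with
        | nil => simp at h1
        | cons x m => exact ⟨m, by simpa using h1⟩
      refine ⟨true, m, rfl, fun hm => ?_⟩
      cases m with
      | nil => simp at hm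
      | cons y m =>
        obtain rfl : y = 1 := by simpa using hm
        have := IsFactor.pair (u := []) h.1.1
        revert this
        decide
    · exact ⟨false, w, rfl, h1⟩
  obtain ⟨-, a, b, hab, ha, hb⟩ := h.1
  by_cases hl : m.getLast? = some 0
  · obtain ⟨m', rfl⟩ := List.getLast?_eq_some_iff.mp hl
    have hF : IsFactor p (m' ++ [0]) := by
      rw [hw] at ha
      exact ha.left.right
    obtain ⟨v, rfl⟩ := hF.exists_hMap_eq (by decide) (by
      cases m' with
      | nil => simp
      | cons x m' => simpa using hm)
    exact ⟨l, true, v, by simp [hw, step], by simp⟩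
  · have hone : m ≠ [] → m.getLast? = some 1 := by
      intro hne
      obtain ⟨m', x, rfl⟩ : ∃ w a, m = w ++ [a] :=
        ⟨_, _, (List.dropLast_append_getLast hne).symm⟩
      rcases letter_cases x with rfl | rfl | rfl
      · simp at hl
      · simp
      · rw [hw, ← List.append_assoc] at h2
        simp at h2
    have hF : ∃ d, d ≠ 1 ∧ IsFactor p (m ++ [d]) := by
      obtain ⟨d, hd1, hd⟩ : ∃ d, d ≠ 1 ∧ IsFactor p (w ++ [d]) := by
        by_cases ha1 : a = 1
        · exact ⟨b, fun hb1 => hab (ha1.trans hb1.symm), hb⟩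
        · exact ⟨a, ha1, ha⟩
      rw [hw, List.append_assoc] at hd
      exact ⟨d, hd1, hd.right⟩
    obtain ⟨d, hd, hF⟩ := hF
    obtain ⟨v, rfl⟩ := hF.exists_hMap_eq hd hm
    refine ⟨l, false, v, by simp [hw, step], fun hv _ => ?_⟩
    have hne : hMap v ≠ [] := fun h => hv (hMap_injective h)
    rw [hw, List.getLast?_append, hone hne]
    rfl

theorem IsBispecial.getLast?_hMap {v : List (Fin 3)} {l r : Bool}
    (h : IsBispecial p (step l r v)) (hv : v ≠ [])
    (hr : r = false → (step l r v).getLast? = some 1) : (hMap v).getLast? = some 1 := by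
  have hne : hMap v ≠ [] := fun h => hv (hMap_injective h)
  cases r with
  | false =>
    have := hr rfl
    rw [step, List.append_assoc, List.getLast?_append] at this
    simpa [hne] using this
  | true =>
    obtain ⟨s, x, hs⟩ : ∃ w a, hMap v = w ++ [a] :=
      ⟨_, _, (List.dropLast_append_getLast hne).symm⟩
    have h1 : IsFactor p (step l true v) := h.1.1
    rw [step, hs] at h1
    have hx := IsFactor.pair (u := (if l then [1] else []) ++ s) (a := x) (b := 0) (v := [])
      (by simpa using h1)
    obtain rfl : x = 1 := by
      clear h1 hs
      revert x
      decide
    rw [hs]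
    simp

/-- Distinct letters around the image need distinct letters around v, and `leftImage l` separates
two admissible letters only if one of them is 1 (l true) or 2 (l false); on the right it is 0 or 1.
These witnesses later pin down the flags. -/
theorem IsBispecial.of_step {v : List (Fin 3)} {l r : Bool} (h : IsBispecial p (step l r v))
    (hv : (hMap v).getLast? = some 1) :
    IsBispecial p v ∧ IsFactor p ((bif l then 1 else 2) :: v) ∧
      IsFactor p (v ++ [bif r then 0 else 1]) := by
  have hne : v ≠ [] := by
    rintro rfl
    simp at hv
  have hleft : ∀ c, IsFactor p (c :: step l r v) →
      ∃ a, IsFactor p (a :: v) ∧ (l = true → a ≠ 2) ∧ leftImage l a = c := by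
    intro c hc
    obtain ⟨d, hd⟩ := hc.exists_append
    obtain ⟨a, b, hab, hl, -, hac, -⟩ := hd.of_step hv
    exact ⟨a, hab.left, hl, hac⟩
  have hright : ∀ d, IsFactor p (step l r v ++ [d]) →
      ∃ b, IsFactor p (v ++ [b]) ∧ (r = true → b ≠ 1) ∧ rightImage r b = d := by
    intro d hd
    obtain ⟨c, hc⟩ := hd.exists_cons
    obtain ⟨a, b, hab, -, hr, -, hbd⟩ := IsFactor.of_step hc hv
    exact ⟨b, IsFactor.right (u := [a]) hab, hr, hbd⟩
  obtain ⟨⟨-, d, d', hdd, hd, hd'⟩, -, c, c', hcc, hc, hc'⟩ := h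
  obtain ⟨a, ha, hal, rfl⟩ := hleft c hc
  obtain ⟨a', ha', hal', rfl⟩ := hleft c' hc'
  obtain ⟨b, hb, hbr, rfl⟩ := hright d hd
  obtain ⟨b', hb', hbr', rfl⟩ := hright d' hd'
  have haa : a ≠ a' := fun h => hcc (by rw [h])
  have hbb : b ≠ b' := fun h => hdd (by rw [h])
  have hA : (bif l then 1 else 2) = a ∨ (bif l then 1 else 2) = a' := by
    clear * - hcc hal hal'
    revert l a a'
    decide
  have hB : (bif r then 0 else 1) = b ∨ (bif r then 0 else 1) = b' := by
    clear * - hdd hbr hbr'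
    revert r b b'
    decide
  refine ⟨⟨⟨hb.left, b, b', hbb, hb, hb'⟩, hb.left, a, a', haa, ha, ha'⟩, ?_, ?_⟩
  · rcases hA with h | h <;> rw [h] <;> assumption
  · rcases hB with h | h <;> rw [h] <;> assumption

/-- If no 1 is prepended, an image not starting with 0 starts with h(1) = 21, which is longer than
its preimage. -/
theorem length_lt_length_step {v : List (Fin 3)} {l r : Bool} (hv : v ≠ [])
    (h : (step l r v).head? ≠ some 0) : v.length < (step l r v).length := by
  have hlen := length_le_length_h v
  cases l with
  | true => simp [step]; omega
  | false =>
    cases v with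
    | nil => exact absurd rfl hv
    | cons a v =>
      have hlen := length_le_length_h v
      rcases letter_cases a with rfl | rfl | rfl
      · simp [step] at h
      · simp [step]; omega
      · simp [step] at h

theorem IsBispecial.exists_eq_chain {w : List (Fin 3)} (h : IsBispecial p w) (hw : w ≠ []) :
    ∃ s n, w = chain s n := by
  induction hN : w.length using Nat.strong_induction_on generalizing w with
  | _ N ih =>
    subst hN
    obtain ⟨l, r, v, rfl, hlast⟩ := h.exists_eq_step
    by_cases hv : v = []
    · subst hv
      have h0 := h.2.head?_ne_zero
      cases l <;> cases r
      · simp [step] at hw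
      · simp [step] at h0
      · exact ⟨true, 0, rfl⟩
      · exact ⟨false, 0, rfl⟩
    · have hlast' := h.getLast?_hMap hv (hlast hv)
      obtain ⟨hbi, hl, hr⟩ := h.of_step hlast'
      obtain ⟨s, n, rfl⟩ := ih _ (length_lt_length_step hv h.2.head?_ne_zero) hbi hv rfl
      refine ⟨s, n + 1, ?_⟩
      -- A chain word is never extended by both 1 and 2 on the left, nor by both 0 and 1 on the
      -- right, so the witnesses force the flags used in `chain`.
      have hl := eq_of_isFactor_cons_chain hl
      have hr := eq_of_isFactor_chain_append hr
      rw [chain]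
      congr 1
      · generalize (n % 2 == 1) = e at *
        clear * - hl
        revert l e
        decide
      · generalize (n % 2 == 1) = e at *
        clear * - hr
        revert r e s
        decide

theorem exists_isBispecial_iff {n : ℕ} (hn : 1 ≤ n) :
    (∃ w : List (Fin 3), w.length = n ∧ IsBispecial p w) ↔ ∃ s k, (chain s k).length = n := by
  constructor
  · rintro ⟨w, rfl, hw⟩
    obtain ⟨s, k, rfl⟩ := hw.exists_eq_chain (List.length_pos_iff.mp hn)
    exact ⟨s, k, rfl⟩
  · rintro ⟨s, k, h⟩
    exact ⟨_, h, isBispecial_chain s k⟩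


/-! Lengths of the words in the two chains. -/

theorem count_hMap (v : List (Fin 3)) :
    (hMap v).count 0 = v.count 0 + v.count 2 ∧ (hMap v).count 1 = v.count 0 + v.count 1 ∧
      (hMap v).count 2 = v.count 1 := by
  induction v with
  | nil => simp
  | cons a v ih =>
    rcases letter_cases a with rfl | rfl | rfl <;> simp [ih] <;> omega

theorem length_eq_count (v : List (Fin 3)) :
    v.length = v.count 0 + v.count 1 + v.count 2 := by
  induction v with
  | nil => simp
  | cons a v ih =>
    rcases letter_cases a with rfl | rfl | rfl <;> simp [ih] <;> omega

/-- This is the recurrence of the characteristic polynomial x^3 - 2x^2 + x - 1 of the incidence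
matrix of h. -/
theorem weight_add_three (n : ℕ) :
    weight (n + 3) + weight (n + 1) = 2 * weight (n + 2) + weight n := by
  induction n with
  | zero => simp [weight]
  | succ n ih =>
    have : weight (n + 1 + 3) = weight (n + 3) + weight (n + 2) + weight n := weight.eq_5 n
    rw [this]
    have h2 : n + 1 + 2 = n + 3 := rfl
    have h1 : n + 1 + 1 = n + 2 := rfl
    rw [h2, h1]
    omega

/-- The difference of the Parikh vectors of `v'` and `v` is the `m`-th of a sequence of vectors
of lengths `weight (m + 2)` on which the incidence matrix of `h` acts as the shift. -/
def ShiftBy (m : ℕ) (v v' : List (Fin 3)) : Prop :=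
  v'.count 0 = v.count 0 + weight m ∧
    v'.count 1 + weight (m + 1) = v.count 1 + weight (m + 2) ∧
    v'.count 2 + weight m = v.count 2 + weight (m + 1)

theorem ShiftBy.step {m : ℕ} {v v' : List (Fin 3)} (h : ShiftBy m v v') (l r : Bool) :
    ShiftBy (m + 1) (step l r v) (step l r v') := by
  obtain ⟨h0, h1, h2⟩ := h
  obtain ⟨a0, a1, a2⟩ := count_hMap v
  obtain ⟨b0, b1, b2⟩ := count_hMap v'
  have hw := weight_add_three m
  have hw1 : weight (m + 1 + 1) = weight (m + 2) := rfl
  have hw2 : weight (m + 1 + 2) = weight (m + 3) := rfl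
  refine ⟨?_, ?_, ?_⟩ <;> simp only [PisotWord.step, List.count_append, a0, a1, a2, b0, b1, b2, hw1,
    hw2] <;> omega

theorem ShiftBy.length_eq {m : ℕ} {v v' : List (Fin 3)} (h : ShiftBy m v v') :
    v'.length = v.length + weight (m + 2) := by
  obtain ⟨h0, h1, h2⟩ := h
  rw [length_eq_count, length_eq_count v]
  omega

/-- An even distance makes the flags agree. Distance 2 does not suffice here: the lengths 1 and 6
differ by 5, which is not a weight. -/
theorem shiftBy_chain_true (n : ℕ) : ShiftBy (n + 3) (chain true n) (chain true (n + 4)) := by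
  induction n with
  | zero => simp [ShiftBy, chain, step, weight]
  | succ n ih =>
    have h := ih.step (n % 2 == 1) ((n % 2 == 1) ^^ true)
    rw [chain, show n + 1 + 4 = n + 4 + 1 from rfl, chain, show (n + 4) % 2 = n % 2 by omega]
    exact h

theorem shiftBy_chain_false (n : ℕ) : ShiftBy (n + 1) (chain false n) (chain false (n + 2)) := by
  induction n with
  | zero => simp [ShiftBy, chain, step, weight]
  | succ n ih =>
    have h := ih.step (n % 2 == 1) ((n % 2 == 1) ^^ false)
    rw [chain, show n + 1 + 2 = n + 2 + 1 from rfl, chain, show (n + 2) % 2 = n % 2 by omega]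
    exact h

theorem length_chain_true (n : ℕ) :
    (chain true (n + 4)).length = (chain true n).length + weight (n + 5) :=
  (shiftBy_chain_true n).length_eq

theorem length_chain_false (n : ℕ) :
    (chain false (n + 2)).length = (chain false n).length + weight (n + 3) :=
  (shiftBy_chain_false n).length_eq

/-! Their representations. -/

theorem Admissible.zero_cons {w : List (Fin 2)} (hw : Admissible w) : Admissible (0 :: w) := by
  refine ⟨?_, ?_⟩ <;> rw [List.infix_cons_iff] <;> rintro (h | h)
  · simp at h
  · exact hw.1 h
  · simp at h
  · exact hw.2 h

theorem Admissible.one_zero_cons {w : List (Fin 2)} (hw : Admissible w) :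
    Admissible (1 :: 0 :: w) := by
  refine ⟨?_, ?_⟩ <;> rw [List.infix_cons_iff] <;> rintro (h | h)
  · simp at h
  · exact hw.zero_cons.1 h
  · simp at h
  · exact hw.zero_cons.2 h

theorem isRep_flatten_one_zero (k : ℕ) (t : List (Fin 2)) (ht : Admissible t)
    {n : ℕ} (hn : value ((List.replicate (k + 1) [1, 0]).flatten ++ t) = n) :
    IsRep n ((List.replicate (k + 1) [1, 0]).flatten ++ t) := by
  refine ⟨by simp [List.replicate_succ], ?_, hn⟩
  clear hn
  induction k + 1 with
  | zero => simpa using ht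
  | succ k ih =>
    simp only [List.replicate_succ, List.flatten_cons, List.append_assoc]
    exact ih.one_zero_cons

theorem isRep_flatten_one_zero_zero_zero (k : ℕ) (t : List (Fin 2)) (ht : Admissible t)
    {n : ℕ} (hn : value ((List.replicate (k + 1) [1, 0, 0, 0]).flatten ++ t) = n) :
    IsRep n ((List.replicate (k + 1) [1, 0, 0, 0]).flatten ++ t) := by
  refine ⟨by simp [List.replicate_succ], ?_, hn⟩
  clear hn
  induction k + 1 with
  | zero => simpa using ht
  | succ k ih =>
    simp only [List.replicate_succ, List.flatten_cons, List.append_assoc]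
    exact ih.zero_cons.zero_cons.one_zero_cons

/-- Each new block 10 contributes exactly the weight in `length_chain_false`; `ht` is the case of a
single block. -/
theorem value_one_zero (k : ℕ) (t : List (Fin 2)) (n : ℕ) (hn : t.length = n)
    (ht : value t + weight (n + 1) = (chain false n).length) :
    value ((List.replicate (k + 1) [1, 0]).flatten ++ t) = (chain false (2 * k + n)).length := by
  induction k with
  | zero => simp [value, hn, ← ht]; omega
  | succ k ih =>
    rw [List.replicate_succ, show 2 * (k + 1) + n = 2 * k + n + 2 by ring, length_chain_false, ← ih]
    simp only [List.flatten_cons, List.cons_append, List.nil_append, value]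
    simp [hn]
    rw [show (k + 1) * 2 + n + 1 = 2 * k + n + 3 by ring]
    omega

/-- Here k = 0 is allowed: the tails 01, 011, 0110 stripped of their leading zero are the
exceptional words 1, 11, 110. -/
theorem value_one_zero_zero_zero (k : ℕ) (t : List (Fin 2)) (n : ℕ) (hn : t.length = n + 2)
    (ht : value t = (chain true n).length) :
    value ((List.replicate k [1, 0, 0, 0]).flatten ++ t) = (chain true (4 * k + n)).length := by
  induction k with
  | zero => simp [ht]
  | succ k ih =>
    rw [List.replicate_succ, show 4 * (k + 1) + n = 4 * k + n + 4 by ring, length_chain_true, ← ih]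
    simp only [List.flatten_cons, List.cons_append, List.nil_append, value]
    simp [hn]
    rw [show k * 4 + (n + 2) + 1 + 1 + 1 = 4 * k + n + 5 by ring]
    omega

/-- The tail 0 alone would correspond to index -1 of the chain, so the induction starts with one
block. -/
theorem value_one_zero_zero_zero_zero (k : ℕ) :
    value ((List.replicate (k + 1) [1, 0, 0, 0]).flatten ++ [0]) =
      (chain true (4 * k + 3)).length := by
  induction k with
  | zero => decide
  | succ k ih =>
    rw [List.replicate_succ, show 4 * (k + 1) + 3 = 4 * k + 3 + 4 by ring, length_chain_true, ← ih]
    simp only [List.flatten_cons, List.cons_append, List.nil_append, value]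
    simp
    rw [show (k + 1) * 4 + 1 + 1 + 1 + 1 = 4 * k + 3 + 5 by ring]
    omega

/-! ### Matching chain lengths with the language. -/

theorem mem_bispecialLengths_iff {w : List (Fin 2)} : w ∈ bispecialLengths ↔
    w = [1] ∨ w = [1, 1] ∨ w = [1, 1, 0] ∨
    (∃ k, ∃ t ∈ ({[], [0]} : Set (List (Fin 2))),
      w = (List.replicate (k + 1) [1, 0]).flatten ++ t) ∨
    (∃ k, ∃ t ∈ ({[0], [0, 1], [0, 1, 1], [0, 1, 1, 0]} : Set (List (Fin 2))),
      w = (List.replicate (k + 1) [1, 0, 0, 0]).flatten ++ t) := by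
  have hplus : ∀ (u x : List (Fin 2)), x ∈ plus u ↔ ∃ k, x = (List.replicate (k + 1) u).flatten := by
    intro u x
    constructor
    · rintro ⟨k, hk, rfl⟩
      exact ⟨k - 1, by rw [Nat.sub_add_cancel hk]⟩
    · rintro ⟨k, rfl⟩
      exact ⟨k + 1, by omega, rfl⟩
  have hmul : ∀ (u : List (Fin 2)) (T : Set (List (Fin 2))) (x : List (Fin 2)),
      x ∈ plus u * (show Language (Fin 2) from T) ↔
        ∃ k, ∃ t ∈ T, x = (List.replicate (k + 1) u).flatten ++ t := by
    intro u T x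
    rw [Language.mem_mul]
    constructor
    · rintro ⟨a, ha, t, ht, rfl⟩
      obtain ⟨k, rfl⟩ := (hplus _ _).mp ha
      exact ⟨k, t, ht, rfl⟩
    · rintro ⟨k, t, ht, rfl⟩
      exact ⟨_, (hplus _ _).mpr ⟨k, rfl⟩, t, ht, rfl⟩
  rw [bispecialLengths, Language.mem_add, Language.mem_add]
  refine (or_congr (or_congr Iff.rfl (hmul _ _ _)) (hmul _ _ _)).trans ?_
  rw [or_assoc]
  change (w = [1] ∨ w = [1, 1] ∨ w = [1, 1, 0]) ∨ _ ↔ _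
  rw [or_assoc, or_assoc]
  rfl

theorem exists_length_chain_iff (n : ℕ) :
    (∃ s k, (chain s k).length = n) ↔ rep n ∈ bispecialLengths := by
  have hnil : Admissible [] := ⟨by decide, by decide⟩
  have h0 : Admissible [0] := ⟨by decide, by decide⟩
  have h01 : Admissible [0, 1] := ⟨by decide, by decide⟩
  have h011 : Admissible [0, 1, 1] := ⟨by decide, by decide⟩
  have h0110 : Admissible [0, 1, 1, 0] := ⟨by decide, by decide⟩
  have v0 := fun k => value_one_zero k [] 0 rfl (by decide)
  have v1 := fun k => value_one_zero k [0] 1 rfl (by decide)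
  have w0 := fun k => value_one_zero_zero_zero k [0, 1] 0 rfl (by decide)
  have w1 := fun k => value_one_zero_zero_zero k [0, 1, 1] 1 rfl (by decide)
  have w2 := fun k => value_one_zero_zero_zero k [0, 1, 1, 0] 2 rfl (by decide)
  have w3 := value_one_zero_zero_zero_zero
  rw [mem_bispecialLengths_iff]
  constructor
  · rintro ⟨s, k, rfl⟩
    simp only [rep_eq_iff]
    cases s
    · right; right; right; left
      refine ⟨k / 2, ?_⟩
      obtain hk | hk : k = 2 * (k / 2) + 0 ∨ k = 2 * (k / 2) + 1 := by omega
      · exact ⟨[], by simp, isRep_flatten_one_zero _ _ hnil ((v0 _).trans (by rw [← hk]))⟩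
      · exact ⟨[0], by simp, isRep_flatten_one_zero _ _ h0 ((v1 _).trans (by rw [← hk]))⟩
    · rcases Nat.lt_or_ge k 3 with hk | hk
      · interval_cases k
        · exact .inl ⟨by decide, ⟨by decide, by decide⟩, by decide⟩
        · exact .inr (.inl ⟨by decide, ⟨by decide, by decide⟩, by decide⟩)
        · exact .inr (.inr (.inl ⟨by decide, ⟨by decide, by decide⟩, by decide⟩))
      · right; right; right; right
        -- The four indices 4q + 3, ..., 4q + 6 share q + 1 blocks 1000 and differ only in the tail.
        refine ⟨(k - 3) / 4, ?_⟩
        generalize hq : (k - 3) / 4 = q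
        obtain hk | hk | hk | hk : k = 4 * q + 3 ∨ k = 4 * (q + 1) + 0 ∨ k = 4 * (q + 1) + 1 ∨
          k = 4 * (q + 1) + 2 := by omega
        · exact ⟨[0], by simp, isRep_flatten_one_zero_zero_zero _ _ h0 (by rw [w3, hk])⟩
        · exact ⟨[0, 1], by simp, isRep_flatten_one_zero_zero_zero _ _ h01 (by rw [w0, hk])⟩
        · exact ⟨[0, 1, 1], by simp, isRep_flatten_one_zero_zero_zero _ _ h011 (by rw [w1, hk])⟩
        · exact ⟨[0, 1, 1, 0], by simp,
            isRep_flatten_one_zero_zero_zero _ _ h0110 (by rw [w2, hk])⟩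
  · have hval : value (rep n) = n := ((rep_eq_iff n _).mp rfl).2.2
    rintro (h | h | h | ⟨k, t, ht, h⟩ | ⟨k, t, ht, h⟩)
    · exact ⟨true, 0, by rw [← hval, h]; decide⟩
    · exact ⟨true, 1, by rw [← hval, h]; decide⟩
    · exact ⟨true, 2, by rw [← hval, h]; decide⟩
    · rcases ht with rfl | rfl
      · exact ⟨false, _, by rw [← hval, h, v0]⟩
      · exact ⟨false, _, by rw [← hval, h, v1]⟩
    · rcases ht with rfl | rfl | rfl | rfl
      · exact ⟨true, _, by rw [← hval, h, w3]⟩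
      · exact ⟨true, _, by rw [← hval, h, w0]⟩
      · exact ⟨true, _, by rw [← hval, h, w1]⟩
      · exact ⟨true, _, by rw [← hval, h, w2]⟩

end PisotWord

theorem theorem7 (n : ℕ) (hn : 1 ≤ n) :
    (∃ w : List (Fin 3), w.length = n ∧ PisotWord.IsBispecial PisotWord.p w) ↔
      PisotWord.rep n ∈ PisotWord.bispecialLengths :=
  (PisotWord.exists_isBispecial_iff hn).trans (PisotWord.exists_length_chain_iff n)
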